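/- Fix a nonempty compact Hausdorff space $X$, an arbitrary first-order language $L_H$ (home sort $H$), and a set of function symbols of sorts $H^n\to S$ ($n\ge 1$). Let $L$ be the two-sorted language (sorts $H$ and $S$) consisting of $L_H$, these symbols, a function symbol $S^n\to S$ for every continuous $f:X^n\to X$ ($n\ge 0$), and a predicate symbol for every closed $C\subseteq X^n$ ($n\ge 1$). A \emph{standard structure} $\langle M,X\rangle$, also written $M$, is an $L$-structure whose home sort is an $L_H$-structure $M$ and whose space sort is $X$ with the intended interpretation. The class $\mathcal F$ is the least class of formulas that contains all $L_H$-formulas and all formulas $t\in C$ ($t$ a tuple of $n\ge 1$ terms of sort $S$, $C\subseteq X^n$ closed) and is closed under $\wedge$, $\vee$ and the quantifiers $\forall,\exists$ of both sorts; $\mathcal H$ is the class of those $\mathcal F$-formulas that contain no quantifier of sort $S$. For a subset $A$ of $M$, $\mathcal F(A)$ and $\mathcal H(A)$ are the corresponding classes with a name added for each element of $A$. An \emph{approximation} $\varphi'>\varphi$ of $\varphi$ is obtained by replacing each atomic formula $t\in C$ occurring in $\varphi$ (leaving the $L_H$-formulas unchanged) by $t\in C'$, for some closed neighbourhood $C'$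 of $C$; in particular $\varphi>\varphi$ if no such atomic formula occurs. A standard structure $M$ is \emph{$\mathcal F$-saturated} if every set of $\mathcal F(M)$-formulas in finitely many free variables (of either sort) that uses fewer than $|M|$ parameters from $M$ and is finitely realized in $M$ is realized in $M$. Let $\mathcal U$ be an $\mathcal F$-saturated standard structure and let $A\subseteq\mathcal U$ with $|A|<|\mathcal U|$. Let $x$ be a finite tuple of variables of sort $H$ and let $\varphi(x)\in\mathcal F(A)$ be such that $\neg\varphi(x)$ is consistent, that is, $\mathcal U\models\neg\varphi(a)$ for some $a\in\mathcal U^{|x|}$. Then there are a formula $\psi(x)\in\mathcal H(A)$ that is consistent (that is, $\mathcal U\models\psi(a)$ for some $a\in\mathcal U^{|x|}$) and an approximation $\psi'>\psi$ such that $\psi'(x)\to\neg\varphi(x)$, that is, for every $a\in\mathcal U^{|x|}$, if $\mathcal U\models\psi'(a)$ then $\mathcal U\models\neg\varphi(a)$. -/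

import Mathlib

universe u v w x y z

/-- The data of a two-sorted language built over a space `X`: the language `home` of the home sort,
and for each `n` the function symbols `mixed n` of sort `H^(n+1) → S`.  The symbols of the space
sort are not listed here because they are determined by `X`: all continuous functions `X^n → X`
and all closed subsets of `X^n`. -/
structure TwoSortedLanguage where
  home : FirstOrder.Language.{u, v}
  mixed : ℕ → Type w

namespace TwoSortedLanguage

/-- The expansion of the language by a name (of home sort) for each element of `A`. -/
abbrev withConstants (L : TwoSortedLanguage.{u, v, w}) (A : Type z) :
    TwoSortedLanguage.{max u z, v, w} where
  home := L.home.withConstants A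
  mixed := L.mixed

/-- Interpretation of the function symbols of sort `H^(n+1) → S`.  A standard structure
`⟨M, X⟩` is a type `M` with `[L.home.Structure M]` and `[L.MixedStructure X M]`. -/
class MixedStructure (L : TwoSortedLanguage.{u, v, w}) (X : Type x) (M : Type z) where
  mixedMap : ∀ {n : ℕ}, L.mixed n → (Fin (n + 1) → M) → X

/-- Naming elements does not change the interpretation of the mixed function symbols. -/
instance (L : TwoSortedLanguage.{u, v, w}) (X : Type x) (M : Type z) [S : L.MixedStructure X M]
    (A : Set M) : (L.withConstants A).MixedStructure X M where
  mixedMap := fun {_} g => S.mixedMap g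

/-- Terms of sort `S`.  Variables of sort `H` are indexed by `α ⊕ Fin n` (`Fin n` being the ones
that may get bound, as in Mathlib's `BoundedFormula`), variables of sort `S` by `Fin m`. -/
inductive SpaceTerm (L : TwoSortedLanguage.{u, v, w}) (X : Type x) [TopologicalSpace X]
    (α : Type y) (n m : ℕ) : Type (max u w x y)
  | var (i : Fin m) : SpaceTerm L X α n m
  | func {k : ℕ} (f : C(Fin k → X, X)) (ts : Fin k → SpaceTerm L X α n m) : SpaceTerm L X α n m
  | mixed {k : ℕ} (g : L.mixed k) (ts : Fin (k + 1) → L.home.Term (α ⊕ Fin n)) :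
      SpaceTerm L X α n m

/-- The value in `X` of a term of sort `S` in the standard structure `⟨M, X⟩`. -/
def SpaceTerm.realize {L : TwoSortedLanguage.{u, v, w}} {X : Type x} [TopologicalSpace X]
    {α : Type y} {n m : ℕ} {M : Type z} [L.home.Structure M] [S : L.MixedStructure X M]
    (a : α → M) (b : Fin n → M) (η : Fin m → X) : SpaceTerm L X α n m → X
  | .var i => η i
  | .func f ts => f (fun i => (ts i).realize a b η)
  | .mixed g ts => S.mixedMap g (fun i => (ts i).realize (Sum.elim a b))

/-- The class `F` of formulas: the least class containing the formulas of the home language and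
the formulas `t ∈ C` (`C` closed in `X^(k+1)`), closed under `∧`, `∨` and all quantifiers
of both sorts. -/
inductive FFormula (L : TwoSortedLanguage.{u, v, w}) (X : Type x) [TopologicalSpace X]
    (α : Type y) : ℕ → ℕ → Type (max u v w x y)
  | home {n m : ℕ} (φ : L.home.BoundedFormula α n) : FFormula L X α n m
  | mem {n m k : ℕ} (t : Fin (k + 1) → SpaceTerm L X α n m)
      (C : TopologicalSpace.Closeds (Fin (k + 1) → X)) : FFormula L X α n m
  | and {n m : ℕ} (φ ψ : FFormula L X α n m) : FFormula L X α n m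
  | or {n m : ℕ} (φ ψ : FFormula L X α n m) : FFormula L X α n m
  | allH {n m : ℕ} (φ : FFormula L X α (n + 1) m) : FFormula L X α n m
  | exH {n m : ℕ} (φ : FFormula L X α (n + 1) m) : FFormula L X α n m
  | allS {n m : ℕ} (φ : FFormula L X α n (m + 1)) : FFormula L X α n m
  | exS {n m : ℕ} (φ : FFormula L X α n (m + 1)) : FFormula L X α n m

namespace FFormula

/-- Truth of a formula in the standard structure `⟨M, X⟩`. -/
def Realize {L : TwoSortedLanguage.{u, v, w}} {X : Type x} [TopologicalSpace X]
    {α : Type y} {M : Type z} [L.home.Structure M] [L.MixedStructure X M] (a : α → M) :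
    ∀ {n m : ℕ}, FFormula L X α n m → (Fin n → M) → (Fin m → X) → Prop
  | _, _, .home φ, b, _ => φ.Realize a b
  | _, _, .mem t C, b, η => (fun i => (t i).realize a b η) ∈ C
  | _, _, .and φ ψ, b, η => φ.Realize a b η ∧ ψ.Realize a b η
  | _, _, .or φ ψ, b, η => φ.Realize a b η ∨ ψ.Realize a b η
  | _, _, .allH φ, b, η => ∀ c : M, φ.Realize a (Fin.snoc b c) η
  | _, _, .exH φ, b, η => ∃ c : M, φ.Realize a (Fin.snoc b c) η
  | _, _, .allS φ, b, η => ∀ ε : X, φ.Realize a b (Fin.snoc η ε)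
  | _, _, .exS φ, b, η => ∃ ε : X, φ.Realize a b (Fin.snoc η ε)

/-- Truth in `⟨M, X⟩` of a formula `φ(x)` whose only free variables are those of the home-sort
tuple `x`. -/
def Holds {L : TwoSortedLanguage.{u, v, w}} {X : Type x} [TopologicalSpace X]
    {α : Type y} {M : Type z} [L.home.Structure M] [L.MixedStructure X M]
    (φ : FFormula L X α 0 0) (a : α → M) : Prop :=
  φ.Realize a default default

/-- The class `H` of formulas: the `F`-formulas without quantifiers of sort `S`. -/
def IsH {L : TwoSortedLanguage.{u, v, w}} {X : Type x} [TopologicalSpace X] {α : Type y} :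
    ∀ {n m : ℕ}, FFormula L X α n m → Prop
  | _, _, .home _ => True
  | _, _, .mem _ _ => True
  | _, _, .and φ ψ => φ.IsH ∧ ψ.IsH
  | _, _, .or φ ψ => φ.IsH ∧ ψ.IsH
  | _, _, .allH φ => φ.IsH
  | _, _, .exH φ => φ.IsH
  | _, _, .allS _ => False
  | _, _, .exS _ => False

/-- `Approx φ φ'` says that `φ'` is an approximation of `φ` (written `φ' > φ`): every `t ∈ C`
occurring in `φ` is replaced by some `t ∈ C'` with `C'` a closed neighbourhood of `C`. -/
inductive Approx {L : TwoSortedLanguage.{u, v, w}} {X : Type x} [TopologicalSpace X]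
    {α : Type y} : ∀ {n m : ℕ}, FFormula L X α n m → FFormula L X α n m → Prop
  | home {n m : ℕ} (φ : L.home.BoundedFormula α n) :
      Approx (FFormula.home φ : FFormula L X α n m) (FFormula.home φ)
  | mem {n m k : ℕ} (t : Fin (k + 1) → SpaceTerm L X α n m)
      (C C' : TopologicalSpace.Closeds (Fin (k + 1) → X))
      (h : (C : Set (Fin (k + 1) → X)) ⊆ interior (C' : Set (Fin (k + 1) → X))) :
      Approx (FFormula.mem t C) (FFormula.mem t C')
  | and {n m : ℕ} {φ φ' ψ ψ' : FFormula L X α n m} :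
      Approx φ φ' → Approx ψ ψ' → Approx (FFormula.and φ ψ) (FFormula.and φ' ψ')
  | or {n m : ℕ} {φ φ' ψ ψ' : FFormula L X α n m} :
      Approx φ φ' → Approx ψ ψ' → Approx (FFormula.or φ ψ) (FFormula.or φ' ψ')
  | allH {n m : ℕ} {φ φ' : FFormula L X α (n + 1) m} :
      Approx φ φ' → Approx (FFormula.allH φ) (FFormula.allH φ')
  | exH {n m : ℕ} {φ φ' : FFormula L X α (n + 1) m} :
      Approx φ φ' → Approx (FFormula.exH φ) (FFormula.exH φ')
  | allS {n m : ℕ} {φ φ' : FFormula L X α n (m + 1)} :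
      Approx φ φ' → Approx (FFormula.allS φ) (FFormula.allS φ')
  | exS {n m : ℕ} {φ φ' : FFormula L X α n (m + 1)} :
      Approx φ φ' → Approx (FFormula.exS φ) (FFormula.exS φ')

end FFormula

/-- `⟨M, X⟩` is `κ`-`F`-saturated: it realizes every type `p(x ; η)` of `F`-formulas, in finitely
many variables of each sort and with fewer than `κ` parameters from `M`, that is finitely realized
in it. -/
def FSaturatedAt (L : TwoSortedLanguage.{u, v, w}) (X : Type x) [TopologicalSpace X] (M : Type z)
    [L.home.Structure M] [L.MixedStructure X M] (κ : Cardinal.{z}) : Prop :=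
  ∀ A : Set M, Cardinal.mk A < κ →
    ∀ (k m : ℕ) (p : Set (FFormula (L.withConstants A) X (Fin k) 0 m)),
      (∀ p₀ : Set (FFormula (L.withConstants A) X (Fin k) 0 m), p₀.Finite → p₀ ⊆ p →
        ∃ (a : Fin k → M) (η : Fin m → X), ∀ φ ∈ p₀, φ.Realize a default η) →
      ∃ (a : Fin k → M) (η : Fin m → X), ∀ φ ∈ p, φ.Realize a default η

/-- `⟨M, X⟩` is `F`-saturated: it is `|M|`-`F`-saturated. -/
def FSaturated (L : TwoSortedLanguage.{u, v, w}) (X : Type x) [TopologicalSpace X] (M : Type z)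
    [L.home.Structure M] [L.MixedStructure X M] : Prop :=
  L.FSaturatedAt X M (Cardinal.mk M)

end TwoSortedLanguage

/-!
The statement follows from a local version of itself (`exists_isH_separating`), proved by induction
on `φ`: if `φ(a, b, η)` fails, where `a`, `b` are of sort `H` and `η` is a tuple of points of `X`,
then some `H`-formula `ψ` *without variables of sort `S`* holds at `(a, b)`, and it has an
approximation `ψ'` such that `ψ'(a', b')` refutes `φ(a', b', η')` for all `a'`, `b'` and for all
`η'` in a neighbourhood of `η`. Allowing `η'` to vary is what eliminates the quantifiers of
sort `S`.

* For `t ∈ C`, `ψ` says that `t`, with the constants `η` in place of its variables of sort `S`,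
  has the value it has at `(a, b, η)`. A neighbourhood of `η` as required exists since `t` depends
  on `η` uniformly in its arguments of sort `H` (`SpaceTerm.tendstoUniformly_realize`): the symbols
  `X^n → X` are uniformly continuous, and arguments of sort `H` enter only below symbols that take
  no argument of sort `S`.
* For `∃ ε`, finitely many of the neighbourhoods of the points `(η, ε)` suffice, because `X` is
  compact.
* For `∃ y` of sort `H`, each `c` yields `ψ_c < ψ_c'` with `ψ_c(a, b, c)`. There are `F`-formulas
  `χ_c < ψ_c'` and `ν_c` with `¬χ_c → ν_c → ¬ψ_c` (`Approx.exists_negation`). No `y` satisfies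
  all `ν_c(a, b, y)`, so by saturation (`exists_finset_of_fSaturated`) some finitely many of them
  are already inconsistent, and the disjunction of the corresponding `χ_c(a, b, y)` holds for
  every `y`.
-/

open FirstOrder FirstOrder.Language Filter Topology Uniformity TopologicalSpace

namespace TwoSortedLanguage

/-! ### Terms of the space sort -/

namespace SpaceTerm

variable {L : TwoSortedLanguage.{u, v, w}} {X : Type x} [TopologicalSpace X] {α : Type y}
  {n m : ℕ} {M : Type z} [L.home.Structure M] [L.MixedStructure X M]

/-- Replace the variables of sort `S` of a term by the constants (that is, the function symbols
`X^0 → X`) that name the points `η`. -/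
def inst (η : Fin m → X) : SpaceTerm L X α n m → SpaceTerm L X α n 0
  | .var i => .func (ContinuousMap.const (Fin 0 → X) (η i)) Fin.elim0
  | .func f ts => .func f fun i => (ts i).inst η
  | .mixed g ts => .mixed g ts

theorem realize_inst (η : Fin m → X) (a : α → M) (b : Fin n → M) (t : SpaceTerm L X α n m) :
    (t.inst η).realize a b default = t.realize a b η := by
  induction t with
  | var i => rfl
  | func f ts ih => simp only [inst, realize, ih]
  | mixed g ts => rfl

/-- The value of a term depends continuously on its variables of sort `S`, uniformly in its
variables of sort `H`. -/
theorem tendstoUniformly_realize {X : Type x} [UniformSpace X] [CompactSpace X]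
    [L.MixedStructure X M] (η : Fin m → X) (t : SpaceTerm L X α n m) :
    TendstoUniformly (fun η' (p : (α → M) × (Fin n → M)) => t.realize p.1 p.2 η')
      (fun p => t.realize p.1 p.2 η) (𝓝 η) := by
  induction t with
  | var i =>
    intro V hV
    have h := (continuous_apply i).continuousAt.eventually (UniformSpace.ball_mem_nhds (η i) hV)
    filter_upwards [h] with η' hη' p using hη'
  | func f ts ih =>
    have hf := CompactSpace.uniformContinuous_of_continuous f.continuous
    refine hf.comp_tendstoUniformly (g := fun x => f x)
      (F := fun η' (p : (α → M) × (Fin n → M)) i => (ts i).realize p.1 p.2 η')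
      (f := fun p i => (ts i).realize p.1 p.2 η) ?_
    rw [tendstoUniformly_iff_tendsto, Pi.uniformity, tendsto_iInf]
    intro i
    rw [tendsto_comap_iff]
    exact tendstoUniformly_iff_tendsto.1 (ih i)
  | mixed g ts =>
    intro V hV
    exact .of_forall fun _ _ => refl_mem_uniformity hV

/-- A point `p` outside a closed set `C` has a closed neighbourhood `D` such that, for `η'` close to
`η`, the tuple of terms `t` cannot take a value in `D` at `η` and a value in `C` at `η'`,
whatever the values of the variables of sort `H`. -/
theorem exists_closeds_separating [CompactSpace X] [T2Space X] {l : ℕ} (η : Fin m → X)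
    (t : Fin l → SpaceTerm L X α n m) (C : Closeds (Fin l → X)) {p : Fin l → X} (hp : p ∉ C) :
    ∃ D : Closeds (Fin l → X), p ∈ interior (D : Set (Fin l → X)) ∧
      ∀ᶠ η' in 𝓝 η, ∀ (a : α → M) (b : Fin n → M),
        (fun i => (t i).realize a b η) ∈ D → (fun i => (t i).realize a b η') ∉ C := by
  let _ : UniformSpace X := uniformSpaceOfCompactR1
  obtain ⟨W, hW, hWC⟩ := UniformSpace.mem_nhds_iff.1 (C.isClosed.isOpen_compl.mem_nhds hp)
  obtain ⟨V, hV, hVW⟩ := comp_mem_uniformity_sets hW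
  obtain ⟨D, ⟨hD, hDc⟩, hDV⟩ :=
    (closed_nhds_basis p).mem_iff.1 (UniformSpace.ball_mem_nhds p hV)
  refine ⟨⟨D, hDc⟩, mem_interior_iff_mem_nhds.2 hD, ?_⟩
  have ht : TendstoUniformly
      (fun η' (q : (α → M) × (Fin n → M)) i => (t i).realize q.1 q.2 η')
      (fun q i => (t i).realize q.1 q.2 η) (𝓝 η) := by
    rw [tendstoUniformly_iff_tendsto, Pi.uniformity, tendsto_iInf]
    intro i
    rw [tendsto_comap_iff]
    exact tendstoUniformly_iff_tendsto.1 (tendstoUniformly_realize η (t i))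
  filter_upwards [ht V hV] with η' hη' a b hab
  exact hWC (hVW ⟨_, hDV hab, hη' (a, b)⟩)

end SpaceTerm

/-! ### Approximations -/

namespace FFormula

section

variable {L : TwoSortedLanguage.{u, v, w}} {X : Type x} [TopologicalSpace X] {α : Type y}
  {n m : ℕ} {M : Type z} [L.home.Structure M] [L.MixedStructure X M]

theorem Approx.isH_iff {φ φ' : FFormula L X α n m} (h : Approx φ φ') : φ.IsH ↔ φ'.IsH := by
  induction h <;> simp_all [IsH]

/-- Between a formula `φ` and an approximation `φ'` there is a formula `χ` of which `φ'` is still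
an approximation, together with a formula `ν` that lies between `¬χ` and `¬φ`. Thus the negation
of an `F`-formula is an `F`-formula up to approximation. -/
theorem Approx.exists_negation [CompactSpace X] [T2Space X] {φ φ' : FFormula L X α n m}
    (h : Approx φ φ') :
    ∃ χ ν : FFormula L X α n m, Approx χ φ' ∧
      ∀ (a : α → M) (b : Fin n → M) (η : Fin m → X),
        (¬ χ.Realize a b η → ν.Realize a b η) ∧ (ν.Realize a b η → ¬ φ.Realize a b η) := by
  induction h with
  | home φ =>
    exact ⟨.home φ, .home φ.not, .home φ, fun a b η => by simp [Realize]⟩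
  | mem t C C' h =>
    obtain ⟨O, hO, hCO, hOC'⟩ := normal_exists_closure_subset C.isClosed isOpen_interior h
    refine ⟨.mem t ⟨closure O, isClosed_closure⟩, .mem t ⟨Oᶜ, hO.isClosed_compl⟩,
      .mem t _ _ hOC', fun a b η => ⟨fun h₁ h₂ => h₁ (subset_closure h₂), fun h₁ h₂ => h₁ (hCO h₂)⟩⟩
  | and _ _ ih₁ ih₂ =>
    obtain ⟨χ₁, ν₁, h₁, H₁⟩ := ih₁
    obtain ⟨χ₂, ν₂, h₂, H₂⟩ := ih₂
    refine ⟨.and χ₁ χ₂, .or ν₁ ν₂, .and h₁ h₂, fun a b η => ?_⟩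
    simp only [Realize, not_and_or]
    exact ⟨Or.imp (H₁ a b η).1 (H₂ a b η).1, Or.imp (H₁ a b η).2 (H₂ a b η).2⟩
  | or _ _ ih₁ ih₂ =>
    obtain ⟨χ₁, ν₁, h₁, H₁⟩ := ih₁
    obtain ⟨χ₂, ν₂, h₂, H₂⟩ := ih₂
    refine ⟨.or χ₁ χ₂, .and ν₁ ν₂, .or h₁ h₂, fun a b η => ?_⟩
    simp only [Realize, not_or]
    exact ⟨And.imp (H₁ a b η).1 (H₂ a b η).1, And.imp (H₁ a b η).2 (H₂ a b η).2⟩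
  | allH _ ih =>
    obtain ⟨χ, ν, h, H⟩ := ih
    refine ⟨.allH χ, .exH ν, .allH h, fun a b η => ?_⟩
    simp only [Realize, not_forall]
    exact ⟨fun ⟨c, hc⟩ => ⟨c, (H _ _ _).1 hc⟩, fun ⟨c, hc⟩ => ⟨c, (H _ _ _).2 hc⟩⟩
  | exH _ ih =>
    obtain ⟨χ, ν, h, H⟩ := ih
    refine ⟨.exH χ, .allH ν, .exH h, fun a b η => ?_⟩
    simp only [Realize, not_exists]
    exact ⟨fun hc c => (H _ _ _).1 (hc c), fun hc c => (H _ _ _).2 (hc c)⟩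
  | allS _ ih =>
    obtain ⟨χ, ν, h, H⟩ := ih
    refine ⟨.allS χ, .exS ν, .allS h, fun a b η => ?_⟩
    simp only [Realize, not_forall]
    exact ⟨fun ⟨c, hc⟩ => ⟨c, (H _ _ _).1 hc⟩, fun ⟨c, hc⟩ => ⟨c, (H _ _ _).2 hc⟩⟩
  | exS _ ih =>
    obtain ⟨χ, ν, h, H⟩ := ih
    refine ⟨.exS χ, .allS ν, .exS h, fun a b η => ?_⟩
    simp only [Realize, not_exists]
    exact ⟨fun hc c => (H _ _ _).1 (hc c), fun hc c => (H _ _ _).2 (hc c)⟩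

/-- Finite conjunctions of `H`-formulas, compatible with approximation. -/
theorem exists_finset_and {ι : Type*} (s : Finset ι) {ψ ψ' : ι → FFormula L X α n m}
    (hH : ∀ i, (ψ i).IsH) (h : ∀ i, Approx (ψ i) (ψ' i)) :
    ∃ θ θ' : FFormula L X α n m, θ.IsH ∧ Approx θ θ' ∧
      ∀ (a : α → M) (b : Fin n → M) (η : Fin m → X),
        (θ.Realize a b η ↔ ∀ i ∈ s, (ψ i).Realize a b η) ∧
        (θ'.Realize a b η ↔ ∀ i ∈ s, (ψ' i).Realize a b η) := by
  classical
  induction s using Finset.induction_on with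
  | empty => exact ⟨.home ⊤, .home ⊤, trivial, .home _, by simp [Realize]⟩
  | insert i s _ ih =>
    obtain ⟨θ, θ', h₁, h₂, h₃⟩ := ih
    exact ⟨.and (ψ i) θ, .and (ψ' i) θ', ⟨hH i, h₁⟩, .and (h i) h₂,
      fun a b η => by simp [Realize, h₃ a b η]⟩

/-- Finite disjunctions of `H`-formulas, compatible with approximation. -/
theorem exists_finset_or {ι : Type*} (s : Finset ι) {ψ ψ' : ι → FFormula L X α n m}
    (hH : ∀ i, (ψ i).IsH) (h : ∀ i, Approx (ψ i) (ψ' i)) :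
    ∃ θ θ' : FFormula L X α n m, θ.IsH ∧ Approx θ θ' ∧
      ∀ (a : α → M) (b : Fin n → M) (η : Fin m → X),
        (θ.Realize a b η ↔ ∃ i ∈ s, (ψ i).Realize a b η) ∧
        (θ'.Realize a b η ↔ ∃ i ∈ s, (ψ' i).Realize a b η) := by
  classical
  induction s using Finset.induction_on with
  | empty => exact ⟨.home ⊥, .home ⊥, trivial, .home _, by simp [Realize]⟩
  | insert i s _ ih =>
    obtain ⟨θ, θ', h₁, h₂, h₃⟩ := ih
    exact ⟨.or (ψ i) θ, .or (ψ' i) θ', ⟨hH i, h₁⟩, .or (h i) h₂,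
      fun a b η => by simp [Realize, h₃ a b η]⟩

/-! ### Refuting a formula by an `H`-formula -/

/-- If `φ(a, b, η)` fails, an `H`-formula `ψ` true at `(a, b)` has an approximation `ψ'` which
refutes `φ(·, ·, η')` for all `η'` close to `η`. The hypothesis `hM` is the form of saturation that
is needed: the formulas `Φ c` are to be thought of as a type over `a`, `b` in one variable. -/
theorem exists_isH_separating [CompactSpace X] [T2Space X] {a : α → M}
    (hM : ∀ {n : ℕ} (b : Fin n → M) (Φ : M → FFormula L X α (n + 1) 0),
      (∀ y, ∃ c, ¬ (Φ c).Realize a (Fin.snoc b y) default) →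
        ∃ s : Finset M, ∀ y, ∃ c ∈ s, ¬ (Φ c).Realize a (Fin.snoc b y) default)
    (φ : FFormula L X α n m) (b : Fin n → M) (η : Fin m → X) (h : ¬ φ.Realize a b η) :
    ∃ ψ ψ' : FFormula L X α n 0, ψ.IsH ∧ Approx ψ ψ' ∧ ψ.Realize a b default ∧
      ∀ᶠ η' in 𝓝 η, ∀ (a' : α → M) (b' : Fin n → M),
        ψ'.Realize a' b' default → ¬ φ.Realize a' b' η' := by
  induction φ with
  | home φ =>
    exact ⟨.home φ.not, .home φ.not, trivial, .home _, by simpa [Realize] using h,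
      .of_forall fun η' a' b' => by simp [Realize]⟩
  | mem t C =>
    obtain ⟨D, hpD, hD⟩ := SpaceTerm.exists_closeds_separating (M := M) η t C h
    refine ⟨.mem (fun i => (t i).inst η) ⟨{fun i => (t i).realize a b η}, isClosed_singleton⟩,
      .mem (fun i => (t i).inst η) D, trivial, .mem _ _ _ (Set.singleton_subset_iff.2 hpD), ?_, ?_⟩
    · simp only [Realize, SpaceTerm.realize_inst]
      exact Set.mem_singleton _
    · simpa only [Realize, SpaceTerm.realize_inst] using hD
  | and φ₁ φ₂ ih₁ ih₂ =>
    by_cases h₁ : φ₁.Realize a b η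
    · obtain ⟨ψ, ψ', hH, hA, hψ, hN⟩ := ih₂ b η fun h₂ => h ⟨h₁, h₂⟩
      exact ⟨ψ, ψ', hH, hA, hψ, hN.mono fun η' H a' b' hψ' h' => H a' b' hψ' h'.2⟩
    · obtain ⟨ψ, ψ', hH, hA, hψ, hN⟩ := ih₁ b η h₁
      exact ⟨ψ, ψ', hH, hA, hψ, hN.mono fun η' H a' b' hψ' h' => H a' b' hψ' h'.1⟩
  | or φ₁ φ₂ ih₁ ih₂ =>
    obtain ⟨ψ₁, ψ₁', hH₁, hA₁, hψ₁, hN₁⟩ := ih₁ b η fun h' => h (.inl h')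
    obtain ⟨ψ₂, ψ₂', hH₂, hA₂, hψ₂, hN₂⟩ := ih₂ b η fun h' => h (.inr h')
    refine ⟨.and ψ₁ ψ₂, .and ψ₁' ψ₂', ⟨hH₁, hH₂⟩, .and hA₁ hA₂, ⟨hψ₁, hψ₂⟩, ?_⟩
    filter_upwards [hN₁, hN₂] with η' H₁ H₂ a' b' hψ' h'
    exact h'.elim (H₁ a' b' hψ'.1) (H₂ a' b' hψ'.2)
  | allH φ ih =>
    obtain ⟨c, hc⟩ := not_forall.1 h
    obtain ⟨ψ, ψ', hH, hA, hψ, hN⟩ := ih (Fin.snoc b c) η hc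
    exact ⟨.exH ψ, .exH ψ', hH, .exH hA, ⟨c, hψ⟩,
      hN.mono fun η' H a' b' ⟨c', hc'⟩ h' => H a' _ hc' (h' c')⟩
  | exH φ ih =>
    choose ψ ψ' hH hA hψ hN using fun c => ih (Fin.snoc b c) η fun hc => h ⟨c, hc⟩
    choose χ ν hχ hν using fun c => (hA c).exists_negation (M := M)
    obtain ⟨s, hs⟩ := hM b ν fun y => ⟨y, fun hy => (hν y _ _ _).2 hy (hψ y)⟩
    obtain ⟨θ, θ', hθH, hθA, hθ⟩ := exists_finset_or (M := M) s
      (fun c => (hχ c).isH_iff.2 ((hA c).isH_iff.1 (hH c))) hχ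
    refine ⟨.allH θ, .allH θ', hθH, .allH hθA, fun y => ?_, ?_⟩
    · obtain ⟨c, hc, hcy⟩ := hs y
      exact (hθ _ _ _).1.2 ⟨c, hc, not_not.1 fun h' => hcy ((hν c _ _ _).1 h')⟩
    · filter_upwards [(eventually_all_finset s).2 fun c _ => hN c] with η' H a' b' hθ' ⟨y, hy⟩
      obtain ⟨c, hc, hcy⟩ := (hθ _ _ _).2.1 (hθ' y)
      exact H c hc a' _ hcy hy
  | @allS n m φ ih =>
    obtain ⟨ε, hε⟩ := not_forall.1 h
    obtain ⟨ψ, ψ', hH, hA, hψ, hN⟩ := ih b (Fin.snoc η ε) hε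
    refine ⟨ψ, ψ', hH, hA, hψ, ?_⟩
    have hc : Continuous fun η' : Fin m → X => (Fin.snoc η' ε : Fin (m + 1) → X) :=
      Continuous.finSnoc (A := fun _ => X) continuous_id continuous_const
    exact (hc.continuousAt.eventually hN).mono fun η' H a' b' hψ' h' => H a' b' hψ' (h' ε)
  | @exS n m φ ih =>
    choose ψ ψ' hH hA hψ hN using fun ε => ih b (Fin.snoc η ε) fun hε => h ⟨ε, hε⟩
    have hc : Continuous fun p : (Fin m → X) × X => (Fin.snoc p.1 p.2 : Fin (m + 1) → X) :=
      Continuous.finSnoc (A := fun _ => X) continuous_fst continuous_snd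
    have hN' := fun ε => mem_nhds_prod_iff.1 ((hc.continuousAt (x := (η, ε))).eventually (hN ε))
    choose P hP Q hQ hPQ using hN'
    obtain ⟨s, hs⟩ := CompactSpace.elim_nhds_subcover Q hQ
    obtain ⟨θ, θ', hθH, hθA, hθ⟩ := exists_finset_and (M := M) s hH hA
    refine ⟨θ, θ', hθH, hθA, (hθ _ _ _).1.2 fun ε _ => hψ ε, ?_⟩
    filter_upwards [(eventually_all_finset s).2 fun ε _ => hP ε] with η' H a' b' hθ' ⟨ε', hε'⟩
    obtain ⟨ε, hεs, hε⟩ := Set.mem_iUnion₂.1 (hs.symm ▸ Set.mem_univ ε' : ε' ∈ ⋃ i ∈ s, Q i)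
    exact hPQ ε (Set.mk_mem_prod (H ε hεs) hε) a' b' ((hθ _ _ _).2.1 hθ' ε hεs) hε'

/-- The existential closure of a formula with respect to its bound variables of sort `H`. -/
def exClosure : ∀ {n : ℕ}, FFormula L X α n m → FFormula L X α 0 m
  | 0, φ => φ
  | _ + 1, φ => exClosure φ.exH

theorem realize_exClosure {φ : FFormula L X α n m} {a : α → M} {η : Fin m → X} :
    φ.exClosure.Realize a default η ↔ ∃ b, φ.Realize a b η := by
  induction n with
  | zero =>
    rw [exClosure]
    exact ⟨fun h => ⟨_, h⟩, fun ⟨b, h⟩ => Subsingleton.elim b default ▸ h⟩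
  | succ n ih =>
    rw [exClosure, ih]
    exact ⟨fun ⟨b, c, h⟩ => ⟨_, h⟩,
      fun ⟨b, h⟩ => ⟨Fin.init b, b (Fin.last n), (Fin.snoc_init_self b).symm ▸ h⟩⟩

end

/-! ### Naming parameters -/

section Substitution

variable {L : TwoSortedLanguage.{u, v, w}} {X : Type x} [TopologicalSpace X] {α : Type y} {β : Type*}
  {M : Type z} {A B : Set M}

/-- Substitute home terms with parameters in a larger set for the variables of sort `H` in `α`
throughout a term of sort `S`. -/
noncomputable def _root_.TwoSortedLanguage.SpaceTerm.substParams (hAB : A ⊆ B)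
    (f : α → (L.home.withConstants B).Term β) {n m : ℕ} :
    SpaceTerm (L.withConstants A) X α n m → SpaceTerm (L.withConstants B) X β n m
  | .var i => .var i
  | .func g ts => .func g fun i => (ts i).substParams hAB f
  | .mixed g ts => .mixed (L := L.withConstants B) g fun i =>
      ((L.home.lhomWithConstantsMap (Set.inclusion hAB)).onTerm (ts i)).subst
        (Sum.elim (Term.relabel Sum.inl ∘ f) (Term.var ∘ Sum.inr))

/-- Substitute home terms with parameters in a larger set for the free variables of sort `H`
throughout a formula; the bound variables are left alone. -/
noncomputable def substParams (hAB : A ⊆ B) (f : α → (L.home.withConstants B).Term β) :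
    ∀ {n m : ℕ}, FFormula (L.withConstants A) X α n m → FFormula (L.withConstants B) X β n m
  | _, _, .home φ => .home
      (((L.home.lhomWithConstantsMap (Set.inclusion hAB)).onBoundedFormula φ).subst f)
  | _, _, .mem t C => .mem (fun i => (t i).substParams hAB f) C
  | _, _, .and φ ψ => .and (φ.substParams hAB f) (ψ.substParams hAB f)
  | _, _, .or φ ψ => .or (φ.substParams hAB f) (ψ.substParams hAB f)
  | _, _, .allH φ => .allH (φ.substParams hAB f)
  | _, _, .exH φ => .exH (φ.substParams hAB f)
  | _, _, .allS φ => .allS (φ.substParams hAB f)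
  | _, _, .exS φ => .exS (φ.substParams hAB f)

variable [L.home.Structure M] [L.MixedStructure X M]

theorem _root_.TwoSortedLanguage.SpaceTerm.realize_substParams (hAB : A ⊆ B)
    (f : α → (L.home.withConstants B).Term β) {n m : ℕ} (a : β → M) (b : Fin n → M)
    (η : Fin m → X) (t : SpaceTerm (L.withConstants A) X α n m) :
    (t.substParams hAB f).realize a b η = t.realize (fun i => (f i).realize a) b η := by
  induction t with
  | var i => rfl
  | func g ts ih => simp only [SpaceTerm.substParams, SpaceTerm.realize, ih]
  | mixed g ts =>
    simp only [SpaceTerm.substParams, SpaceTerm.realize, Term.realize_subst]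
    refine congrArg (MixedStructure.mixedMap (L := L) (X := X) (M := M) g) (funext fun i => ?_)
    rw [← LHom.realize_onTerm (L.home.lhomWithConstantsMap (Set.inclusion hAB)) (ts i)]
    congr 1
    funext j
    cases j <;> simp

theorem realize_substParams (hAB : A ⊆ B) (f : α → (L.home.withConstants B).Term β) {n m : ℕ}
    (φ : FFormula (L.withConstants A) X α n m) (a : β → M) (b : Fin n → M) (η : Fin m → X) :
    (φ.substParams hAB f).Realize a b η ↔ φ.Realize (fun i => (f i).realize a) b η := by
  induction φ with
  | home φ =>
    simp only [substParams, Realize, BoundedFormula.realize_subst]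
    exact LHom.realize_onBoundedFormula _ φ
  | mem t C => simp only [substParams, Realize, SpaceTerm.realize_substParams]
  | _ => simp_all only [substParams, Realize]

end Substitution

end FFormula

/-! ### Saturation -/

/-- Saturation for a family of formulas `Φ c` in one home variable, with parameters `a`, `b` in the
place of the remaining variables: if the family is not realized, then it has a finite subfamily
that is not realized. -/
theorem exists_finset_of_fSaturated {L : TwoSortedLanguage.{u, v, w}} {X : Type x}
    [TopologicalSpace X] {M : Type z} [L.home.Structure M] [L.MixedStructure X M]
    (hM : L.FSaturated X M) {A : Set M} (hA : Cardinal.mk A < Cardinal.mk M) {k n : ℕ}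
    (a : Fin k → M) (b : Fin n → M)
    (Φ : M → FFormula (L.withConstants A) X (Fin k) (n + 1) 0)
    (h : ∀ y, ∃ c, ¬ (Φ c).Realize a (Fin.snoc b y) default) :
    ∃ s : Finset M, ∀ y, ∃ c ∈ s, ¬ (Φ c).Realize a (Fin.snoc b y) default := by
  classical
  -- A finite structure need not have fewer parameters than elements, but then all `c` can be taken.
  rcases finite_or_infinite M with hfin | hinf
  · have := Fintype.ofFinite M
    exact ⟨Finset.univ, fun y => (h y).imp fun c hc => ⟨Finset.mem_univ c, hc⟩⟩
  let B : Set M := A ∪ (Set.range a ∪ Set.range b)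
  have hAB : A ⊆ B := Set.subset_union_left
  have hB : Cardinal.mk B < Cardinal.mk M := by
    refine (Cardinal.mk_union_le _ _).trans_lt
      (Cardinal.add_lt_of_lt (Cardinal.aleph0_le_mk M) hA ?_)
    exact (Cardinal.lt_aleph0_iff_set_finite.2
      ((Set.finite_range a).union (Set.finite_range b))).trans_le (Cardinal.aleph0_le_mk M)
  let f : Fin k → (L.home.withConstants B).Term (Fin 1) := fun i =>
    (L.home.con (⟨a i, .inr (.inl ⟨i, rfl⟩)⟩ : B)).term
  let g : Fin (n + 1) → (L.home.withConstants B).Term (Fin 1 ⊕ Fin (n + 1)) :=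
    Fin.snoc (fun i => (L.home.con (⟨b i, .inr (.inr ⟨i, rfl⟩)⟩ : B)).term) (.var (.inl 0))
  let E : (L.home.withConstants B).BoundedFormula (Fin 1) (n + 1) :=
    BoundedFormula.iInf fun i => (Term.var (.inr i)).bdEqual (g i)
  -- `θ c` says of `y` that `Φ c` holds at `a`, `b`, `y`: the tuple `(b, y)` is quantified away,
  -- and recovered by means of the equations `E`.
  let θ : M → FFormula (L.withConstants B) X (Fin 1) 0 0 := fun c =>
    FFormula.exClosure (.and (.home E) ((Φ c).substParams hAB f))
  have hE : ∀ (y : Fin 1 → M) (d : Fin (n + 1) → M), E.Realize y d ↔ d = Fin.snoc b (y 0) := by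
    intro y d
    simp only [E, BoundedFormula.realize_iInf, BoundedFormula.realize_bdEqual, Term.realize_var,
      Sum.elim_inr, funext_iff]
    refine forall_congr' fun i => ?_
    cases i using Fin.lastCases <;> simp [g]
  have hθ : ∀ (c : M) (y : Fin 1 → M),
      (θ c).Realize y default default ↔ (Φ c).Realize a (Fin.snoc b (y 0)) default := by
    intro c y
    have hf : (fun i => (f i).realize y) = a := funext fun i => by simp [f]
    simp only [θ, FFormula.realize_exClosure, FFormula.Realize, FFormula.realize_substParams, hf]
    simp only [hE]
    exact exists_eq_left
  by_contra! hcon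
  obtain ⟨y, η, hy⟩ := hM B hB 1 0 (Set.range θ) fun p₀ hfin hsub => by
    have hsub' : ∀ φ ∈ p₀, ∃ c, θ c = φ := fun _ hφ => hsub hφ
    choose! c hc using hsub'
    obtain ⟨y, hy⟩ := hcon (hfin.toFinset.image c)
    refine ⟨fun _ => y, default, fun φ hφ => ?_⟩
    have hcφ := (hθ (c φ) fun _ => y).2
      (hy _ (Finset.mem_image_of_mem c (hfin.mem_toFinset.2 hφ)))
    rwa [hc φ hφ] at hcφ
  obtain ⟨c, hc⟩ := h (y 0)
  exact hc ((hθ c y).1 (Subsingleton.elim η default ▸ hy _ ⟨c, rfl⟩))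

end TwoSortedLanguage

theorem mainTheorem7 (L : TwoSortedLanguage.{u, v, w})
    (X : Type x) [TopologicalSpace X] [CompactSpace X] [T2Space X] [Nonempty X]
    (U : Type z) [L.home.Structure U] [L.MixedStructure X U] (hU : L.FSaturated X U)
    (A : Set U) (hA : Cardinal.mk A < Cardinal.mk U)
    (k : ℕ) (φ : TwoSortedLanguage.FFormula (L.withConstants A) X (Fin k) 0 0)
    (hφ : ∃ a : Fin k → U, ¬ φ.Holds a) :
    ∃ ψ ψ' : TwoSortedLanguage.FFormula (L.withConstants A) X (Fin k) 0 0,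
      ψ.IsH ∧ (∃ a : Fin k → U, ψ.Holds a) ∧
        TwoSortedLanguage.FFormula.Approx ψ ψ' ∧
        ∀ a : Fin k → U, ψ'.Holds a → ¬ φ.Holds a := by
  obtain ⟨a, ha⟩ := hφ
  obtain ⟨ψ, ψ', hH, hA', hψ, hN⟩ := TwoSortedLanguage.FFormula.exists_isH_separating
    (fun b Φ => TwoSortedLanguage.exists_finset_of_fSaturated hU hA a b Φ) φ default default ha
  exact ⟨ψ, ψ', hH, ⟨a, hψ⟩, hA', fun a' => hN.self_of_nhds a' default⟩
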